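/- Call a group $L$ locally normally finite if every finite subset of $L$ is contained in a finite normal subgroup of $L$. For a unitary representation $\pi$ of a (discrete) group $G$ on a complex Hilbert space $\mathcal H$, let $Z^1(G,\pi)$ be the space of $1$-cocycles, i.e. maps $b:G\to\mathcal H$ with $b(gh)=b(g)+\pi_g b(h)$ for all $g,h\in G$, with the topology of uniform convergence on finite subsets of $G$; let $B^1(G,\pi)\subseteq Z^1(G,\pi)$ be the subspace of $1$-coboundaries $g\mapsto v-\pi_g v$, $v\in\mathcal H$; and let $\overline{H}^1(G,\pi)=Z^1(G,\pi)/\overline{B^1(G,\pi)}$ be the first reduced cohomology. The group $G$ has property $H_{\mathrm T}$ (resp. $H_{\mathrm{FD}}$) if every unitary representation $\pi$ of $G$ with $\overline{H}^1(G,\pi)\neq 0$ has a nonzero subrepresentation which is trivial (resp. finite dimensional). Theorem. Let $G$ be a finitely generated group that fits in an exact sequence of groups $$1\to L\to G\to\mathbb Z\to 1,$$ where $L$ is locally normally finite. Then $G$ has property $H_{\mathrm T}$, and hence also property $H_{\mathrm{FD}}$. -/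

import Mathlib

universe v u w

/-- A group is locally normally finite if every finite subset is contained in a finite normal
subgroup. -/
def IsLocallyNormallyFinite (L : Type*) [Group L] : Prop :=
  ∀ S : Set L, S.Finite → ∃ N : Subgroup L, N.Normal ∧ (N : Set L).Finite ∧ S ⊆ N

namespace UnitaryRep

/-! A unitary representation of the (discrete) group `G` on the complex Hilbert space `H` is a
group homomorphism from `G` to the group `H ≃ₗᵢ[ℂ] H` of surjective linear isometries of `H`,
which is the unitary group of `H`. -/

section

variable {G : Type*} [Group G] {H : Type*} [NormedAddCommGroup H] [InnerProductSpace ℂ H]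

/-- The space `Z¹(G, π)` of `1`-cocycles, with the topology of pointwise convergence on `G`, that
is, of uniform convergence on finite subsets of `G` (the subspace topology from `G → H`). -/
def oneCocycles (π : G →* (H ≃ₗᵢ[ℂ] H)) : Submodule ℂ (G → H) where
  carrier := {b | ∀ g h : G, b (g * h) = b g + π g (b h)}
  add_mem' := by
    intro a b ha hb g h
    simp only [Pi.add_apply, ha g h, hb g h, map_add]
    abel
  zero_mem' := by
    intro g h
    simp
  smul_mem' := by
    intro c b hb g h
    simp only [Pi.smul_apply, hb g h, map_smul, smul_add]

/-- The linear map sending a vector `v` to the `1`-coboundary `g ↦ v - π g v`. -/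
def coboundary (π : G →* (H ≃ₗᵢ[ℂ] H)) : H →ₗ[ℂ] oneCocycles π where
  toFun v := ⟨fun g => v - π g v, by
    intro g h
    simp only [map_mul, LinearIsometryEquiv.coe_mul, Function.comp_apply, map_sub]
    abel⟩
  map_add' := by
    intro v w
    ext g
    simp only [map_add, Submodule.coe_add, Pi.add_apply]
    abel
  map_smul' := by
    intro c v
    ext g
    simp [smul_sub]

/-- The subspace `B¹(G, π)` of `1`-coboundaries in `Z¹(G, π)`. -/
def oneCoboundaries (π : G →* (H ≃ₗᵢ[ℂ] H)) : Submodule ℂ (oneCocycles π) :=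
  LinearMap.range (coboundary π)

/-- The first reduced cohomology: the quotient of `Z¹(G, π)` by the closure of `B¹(G, π)`. -/
abbrev ReducedH1 (π : G →* (H ≃ₗᵢ[ℂ] H)) : Type _ :=
  oneCocycles π ⧸ (oneCoboundaries π).topologicalClosure

/-- `W` is (the space of) a subrepresentation of `π`: a nonzero closed invariant subspace. -/
structure IsSubrep (π : G →* (H ≃ₗᵢ[ℂ] H)) (W : Submodule ℂ H) : Prop where
  ne_bot : W ≠ ⊥
  isClosed : IsClosed (W : Set H)
  map_mem : ∀ g : G, ∀ w ∈ W, π g w ∈ W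

end

end UnitaryRep

/-- Shalom's property `H_T`: every unitary representation with nonzero first reduced cohomology
has a (nonzero) trivial subrepresentation. -/
def PropertyHT (G : Type u) [Group G] : Prop :=
  ∀ (H : Type v) [NormedAddCommGroup H] [InnerProductSpace ℂ H] [CompleteSpace H]
    (π : G →* (H ≃ₗᵢ[ℂ] H)), Nontrivial (UnitaryRep.ReducedH1 π) →
      ∃ W : Submodule ℂ H, UnitaryRep.IsSubrep π W ∧ ∀ g : G, ∀ w ∈ W, π g w = w

/-- Shalom's property `H_FD`: every unitary representation with nonzero first reduced cohomology
has a (nonzero) finite dimensional subrepresentation. -/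
def PropertyHFD (G : Type u) [Group G] : Prop :=
  ∀ (H : Type v) [NormedAddCommGroup H] [InnerProductSpace ℂ H] [CompleteSpace H]
    (π : G →* (H ≃ₗᵢ[ℂ] H)), Nontrivial (UnitaryRep.ReducedH1 π) →
      ∃ W : Submodule ℂ H, UnitaryRep.IsSubrep π W ∧ FiniteDimensional ℂ W

/-!
Write `L` as the kernel of `G → ℤ` and let `t` lift `1 : ℤ`. Since `G` is finitely generated, it is
generated by `t` and a finite subgroup `F` normal in `L`. The conjugates `tʲ F t⁻ʲ` are normal in `L`
too, so the finite group `Λ n` they generate for `|j| ≤ n` is their product as a set; as powers of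
`t` telescope in such a product, elements of `Λ n` have word length `O(n)`
(`exists_isLinearFiltration`). This is where local normal finiteness enters.

Let `π` be a representation without nonzero invariant vectors and `b` a cocycle. On the finite group
`Λ n`, `b` is the coboundary of its average `v n` (`exists_primitive`). The `v n` have orthogonal
increments along the decreasing subspaces `E n` of `Λ n`-fixed vectors, and `‖v n‖ = O(n)` by the
bound on word length. The cocycle `b - ∂(v n)` vanishes on `Λ n`, so that its value at `t` is
nearly `Λ n`-invariant: it lies in `E (n - 1)`. The vectors `v n` themselves need not make this value
small, but correcting `v 0` by vectors of `E 0` does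
(`mem_closure_sub_of_linear_growth`). Otherwise some `x` orthogonal to all `z - π t z`, `z ∈ E 0`,
would have a nonzero inner product `θ` with `(b - ∂(v n)) t`, for every `n` the same. As
there are no invariant vectors, `x` is orthogonal to `⨅ n, E n`, so its components along `E` are
square summable; the increments of `v` up to `n` have squared norms summing to
`‖v n‖² - ‖v 0‖² = O(n²)`, and summing over `n ≤ k < 2n` with Cauchy–Schwarz gives `n |θ| = o(n)`.

Hence `b - ∂u` can be made to vanish on `F` and to be arbitrarily small at `t`. As `F` and `t`
generate `G`, `b` is in the closure of the coboundaries. So nonzero reduced cohomology forces a nonzero invariant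
vector, and its span is a trivial subrepresentation of dimension one.
-/

/-! ### Increasing sequences of finite subgroups of linear word length -/

/-- The product `F · φ(F) · ⋯ · φⁿ(F)`, as the subgroup generated by its factors. When `F` is
normal this subgroup is the set-theoretic product. -/
def iteratedProduct {L : Type*} [Group L] (φ : MulAut L) (F : Subgroup L) : ℕ → Subgroup L
  | 0 => F
  | n + 1 => F ⊔ (iteratedProduct φ F n).map φ.toMonoidHom

section

variable {L : Type*} [Group L] {φ : MulAut L} {F : Subgroup L}

lemma map_mem_iteratedProduct_succ {n : ℕ} {a : L} (ha : a ∈ iteratedProduct φ F n) :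
    φ a ∈ iteratedProduct φ F (n + 1) :=
  Subgroup.mem_sup_right (Subgroup.mem_map_of_mem φ.toMonoidHom ha)

lemma iteratedProduct_le_succ (n : ℕ) :
    iteratedProduct φ F n ≤ iteratedProduct φ F (n + 1) := by
  induction n with
  | zero => exact le_sup_left
  | succ n ih => exact sup_le_sup_left (Subgroup.map_mono ih) F

lemma exists_of_mem_iteratedProduct_succ [F.Normal] {n : ℕ} {a : L}
    (ha : a ∈ iteratedProduct φ F (n + 1)) :
    ∃ y ∈ F, ∃ z ∈ iteratedProduct φ F n, y * φ z = a := by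
  obtain ⟨y, hy, _, ⟨z, hz, rfl⟩, rfl⟩ := Subgroup.mem_sup_of_normal_left.1 ha
  exact ⟨y, hy, z, hz, rfl⟩

lemma finite_iteratedProduct [F.Normal] (hF : (F : Set L).Finite) (n : ℕ) :
    (iteratedProduct φ F n : Set L).Finite := by
  induction n with
  | zero => exact hF
  | succ n ih =>
    refine (hF.image2 (fun y z => y * φ z) ih).subset fun a ha => ?_
    obtain ⟨y, hy, z, hz, h⟩ := exists_of_mem_iteratedProduct_succ ha
    exact ⟨y, hy, z, hz, h⟩

end

/-- An increasing sequence of finite subgroups `Λ n` of `G` which conjugation by `t` and `t⁻¹` shifts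
by at most one step, such that `t` and `Λ 0` generate `G`, and whose elements have word length
`O(n)`. The last property is expressed by saying that every subadditive function on `G` grows at
most linearly along the sequence. -/
structure IsLinearFiltration {G : Type*} [Group G] (t : G) (Λ : ℕ → Subgroup G) : Prop where
  finite : ∀ n, (Λ n : Set G).Finite
  monotone : Monotone Λ
  conj_mem : ∀ n, ∀ g ∈ Λ n, t * g * t⁻¹ ∈ Λ (n + 1)
  inv_conj_mem : ∀ n, ∀ g ∈ Λ n, t⁻¹ * g * t ∈ Λ (n + 1)
  closure_eq_top : Subgroup.closure (insert t (Λ 0 : Set G)) = ⊤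
  growth : ∀ f : G → ℝ, (∀ g h, f (g * h) ≤ f g + f h) →
    ∃ C, ∀ n, ∀ g ∈ Λ n, f g ≤ C * (n + 1)

section

variable {G : Type u} [Group G] {L : Type w} [Group L]

/-- A finitely generated group mapping onto `ℤ` with locally normally finite kernel is generated by
a lift `t` of `1 : ℤ` and a finite normal subgroup of the kernel. -/
lemma exists_generating_lift [Group.FG G] (S : GroupExtension L G (Multiplicative ℤ))
    (hL : IsLocallyNormallyFinite L) :
    ∃ (t : G) (F : Subgroup L), F.Normal ∧ (F : Set L).Finite ∧
      Subgroup.closure (insert t (F.map S.inl : Set G)) = ⊤ := by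
  obtain ⟨X, hX, hXfin⟩ := Group.fg_iff.1 ‹Group.FG G›
  obtain ⟨t, ht⟩ := S.rightHom_surjective (Multiplicative.ofAdd 1)
  have key : ∀ g : G, ∃ l : L, S.inl l * t ^ (S.rightHom g).toAdd = g := by
    intro g
    have : g * (t ^ (S.rightHom g).toAdd)⁻¹ ∈ S.inl.range := by
      rw [S.range_inl_eq_ker_rightHom, MonoidHom.mem_ker, map_mul, map_inv, map_zpow, ht,
        ← ofAdd_zsmul]
      simp
    obtain ⟨l, hl⟩ := this
    exact ⟨l, by rw [hl]; group⟩
  choose l hl using key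
  obtain ⟨F, hFn, hF, hXF⟩ := hL (l '' X) (hXfin.image l)
  refine ⟨t, F, hFn, hF, ?_⟩
  rw [eq_top_iff, ← hX, Subgroup.closure_le]
  intro g hg
  rw [← hl g]
  refine mul_mem (Subgroup.subset_closure (Set.mem_insert_of_mem _ ?_))
    (zpow_mem (Subgroup.subset_closure (Set.mem_insert _ _)) _)
  exact Subgroup.mem_map_of_mem S.inl (hXF ⟨g, hg, rfl⟩)

/-- The subgroups `Λ n = t⁻ⁿ F tⁿ · t⁻ⁿ⁺¹ F tⁿ⁻¹ ⋯ tⁿ F t⁻ⁿ` form a linear filtration: because the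
factors are normal in `L`, each element is a product with a single factor from each conjugate, and
the powers of `t` telescope. -/
lemma exists_isLinearFiltration [Group.FG G] (S : GroupExtension L G (Multiplicative ℤ))
    (hL : IsLocallyNormallyFinite L) :
    ∃ (t : G) (Λ : ℕ → Subgroup G), IsLinearFiltration t Λ := by
  obtain ⟨t, F, hFn, hF, hgen⟩ := exists_generating_lift S hL
  set φ : MulAut L := S.conjAct t
  have hφ : ∀ l, S.inl (φ l) = t * S.inl l * t⁻¹ := fun l => S.inl_conjAct_comm
  set B : ℕ → Subgroup G := fun n => (iteratedProduct φ F n).map S.inl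
  have hB : ∀ n, ∀ g ∈ B n, t * g * t⁻¹ ∈ B (n + 1) := by
    rintro n _ ⟨a, ha, rfl⟩
    exact ⟨φ a, map_mem_iteratedProduct_succ ha, hφ a⟩
  have hBle : ∀ n, B n ≤ B (n + 1) := fun n => Subgroup.map_mono (iteratedProduct_le_succ n)
  set Λ : ℕ → Subgroup G := fun n => (B (2 * n)).comap (MulAut.conj (t ^ n)).toMonoidHom
  have hΛ : ∀ n g, g ∈ Λ n ↔ t ^ n * g * (t ^ n)⁻¹ ∈ B (2 * n) := fun n g => Iff.rfl
  have hΛ0 : Λ 0 = F.map S.inl := by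
    ext g
    rw [hΛ]
    simp [B, iteratedProduct]
  refine ⟨t, Λ, ⟨fun n => ?_, monotone_nat_of_le_succ fun n g hg => ?_, fun n g hg => ?_,
    fun n g hg => ?_, by rw [hΛ0]; exact hgen, fun f hf => ?_⟩⟩
  · have hBfin : (B (2 * n) : Set G).Finite := by
      simpa [B] using (finite_iteratedProduct hF (2 * n)).image S.inl
    exact Set.Finite.preimage (f := MulAut.conj (t ^ n))
      (MulAut.conj (t ^ n)).injective.injOn hBfin
  · rw [hΛ] at hg ⊢
    have e : t ^ (n + 1) * g * (t ^ (n + 1))⁻¹ = t * (t ^ n * g * (t ^ n)⁻¹) * t⁻¹ := by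
      rw [pow_succ']; group
    rw [e]
    exact hBle _ (hB _ _ hg)
  · rw [hΛ] at hg ⊢
    have e : t ^ (n + 1) * (t * g * t⁻¹) * (t ^ (n + 1))⁻¹ =
        t * (t * (t ^ n * g * (t ^ n)⁻¹) * t⁻¹) * t⁻¹ := by
      group
    rw [e]
    exact hB _ _ (hB _ _ hg)
  · rw [hΛ] at hg ⊢
    have e : t ^ (n + 1) * (t⁻¹ * g * t) * (t ^ (n + 1))⁻¹ = t ^ n * g * (t ^ n)⁻¹ := by
      rw [pow_succ]; group
    rw [e]
    exact hBle _ (hBle _ hg)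
  · obtain ⟨M, hM⟩ := (hF.image fun l => f (S.inl l)).bddAbove
    have hM : ∀ l ∈ F, f (S.inl l) ≤ M := fun l hl => hM ⟨l, hl, rfl⟩
    have hM1 : f 1 ≤ M := by simpa using hM 1 F.one_mem
    have hf1 : 0 ≤ f 1 := by simpa using hf 1 1
    set T := |f t| + |f t⁻¹|
    have hT : f t + f t⁻¹ ≤ T := add_le_add (le_abs_self _) (le_abs_self _)
    have hT1 : f t ≤ T := (le_abs_self _).trans (le_add_of_nonneg_right (abs_nonneg _))
    have hT2 : f t⁻¹ ≤ T := (le_abs_self _).trans (le_add_of_nonneg_left (abs_nonneg _))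
    have hpow : ∀ n : ℕ, f (t ^ n) ≤ M + n * T := by
      intro n
      induction n with
      | zero => simpa using hM1
      | succ n ih =>
        have := hf (t ^ n) t
        rw [pow_succ]; push_cast; linarith
    have hpow' : ∀ n : ℕ, f (t ^ n)⁻¹ ≤ M + n * T := by
      intro n
      induction n with
      | zero => simpa using hM1
      | succ n ih =>
        have := hf t⁻¹ (t ^ n)⁻¹
        rw [pow_succ, mul_inv_rev]; push_cast; linarith
    have hBf : ∀ n : ℕ, ∀ g ∈ B n, f g ≤ (M + T) * (n + 1) := by
      intro n
      induction n with
      | zero =>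
        rintro _ ⟨a, ha, rfl⟩
        have h0 : 0 ≤ T := by positivity
        have := hM a ha
        push_cast; linarith
      | succ n ih =>
        rintro _ ⟨a, ha, rfl⟩
        obtain ⟨y, hy, z, hz, rfl⟩ := exists_of_mem_iteratedProduct_succ ha
        rw [map_mul, hφ]
        have h1 := hf (S.inl y) (t * S.inl z * t⁻¹)
        have h2 := hf (t * S.inl z) t⁻¹
        have h3 := hf t (S.inl z)
        have h4 := hM y hy
        have h5 := ih _ ⟨z, hz, rfl⟩
        push_cast; linarith
    refine ⟨4 * (M + T), fun n g hg => ?_⟩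
    have h1 := hBf _ _ ((hΛ n g).1 hg)
    have h2 := hf ((t ^ n)⁻¹ * (t ^ n * g * (t ^ n)⁻¹)) (t ^ n)
    have h3 := hf (t ^ n)⁻¹ (t ^ n * g * (t ^ n)⁻¹)
    have h4 : (t ^ n)⁻¹ * (t ^ n * g * (t ^ n)⁻¹) * t ^ n = g := by group
    rw [h4] at h2
    have h5 := hpow n
    have h6 := hpow' n
    have hM0 : 0 ≤ M := hf1.trans hM1
    have hT0 : 0 ≤ T := by positivity
    have : 0 ≤ M * n := by positivity
    push_cast at h1
    linarith

end

/-! ### A summation estimate -/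

open Filter Topology in
/-- If `K a + r s` dominates a constant `θ`, where `r` is square summable with tails controlled by
`a → 0`, and the partial sums of `s²` grow at most quadratically, then `θ ≤ 0`: sum over the block
`[n, 2n)` and apply Cauchy–Schwarz. -/
lemma nonpos_of_le_mul_add_mul {θ K C : ℝ} {a r s q : ℕ → ℝ} (ha : ∀ j, 0 ≤ a j)
    (ha0 : Tendsto a atTop (𝓝 0)) (hr : ∀ j, r j ^ 2 = a j ^ 2 - a (j + 1) ^ 2)
    (hs : ∀ j, s j ^ 2 = q (j + 1) - q j) (hq : ∀ j, 0 ≤ q j) (hC : 0 ≤ C) (hK : 0 ≤ K)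
    (hqC : ∀ j : ℕ, q j ≤ (C * (j + 1)) ^ 2) (hθ : ∀ j, θ ≤ K * a j + r j * s j) : θ ≤ 0 := by
  have hanti : Antitone a := antitone_nat_of_succ_le fun j =>
    (pow_le_pow_iff_left₀ (ha _) (ha _) two_ne_zero).1 (by nlinarith [hr j, sq_nonneg (r j)])
  have key : ∀ n : ℕ, 1 ≤ n → θ ≤ (K + 3 * C) * a n := by
    intro n hn
    have h1 : ∑ i ∈ Finset.range n, θ ≤
        ∑ i ∈ Finset.range n, (K * a n + r (n + i) * s (n + i)) :=
      Finset.sum_le_sum fun i _ => (hθ (n + i)).trans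
        (add_le_add_left (mul_le_mul_of_nonneg_left (hanti (Nat.le_add_right n i)) hK) _)
    rw [Finset.sum_add_distrib, Finset.sum_const, Finset.sum_const, Finset.card_range,
      nsmul_eq_mul, nsmul_eq_mul] at h1
    have h2 : ∑ i ∈ Finset.range n, r (n + i) ^ 2 ≤ a n ^ 2 := by
      have : ∑ i ∈ Finset.range n, r (n + i) ^ 2 = a n ^ 2 - a (n + n) ^ 2 := by
        simp_rw [hr]
        exact Finset.sum_range_sub' (fun i => a (n + i) ^ 2) n
      rw [this]
      linarith [sq_nonneg (a (n + n))]
    have h3 : ∑ i ∈ Finset.range n, s (n + i) ^ 2 ≤ (3 * C * n) ^ 2 := by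
      have : ∑ i ∈ Finset.range n, s (n + i) ^ 2 = q (n + n) - q n := by
        simp_rw [hs]
        exact Finset.sum_range_sub (fun i => q (n + i)) n
      rw [this]
      have hn' : (1 : ℝ) ≤ n := by exact_mod_cast hn
      have h4 : (C * ((n + n : ℕ) + 1 : ℝ)) ^ 2 ≤ (3 * C * n) ^ 2 := by
        apply pow_le_pow_left₀ (by positivity)
        push_cast
        nlinarith
      linarith [hqC (n + n), hq n]
    have h4 : ∑ i ∈ Finset.range n, r (n + i) * s (n + i) ≤ a n * (3 * C * n) := by
      refine abs_le_of_sq_le_sq' ?_ (by have := ha n; positivity) |>.2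
      refine (Finset.sum_mul_sq_le_sq_mul_sq _ _ _).trans ?_
      rw [mul_pow]
      exact mul_le_mul h2 h3 (Finset.sum_nonneg fun _ _ => sq_nonneg _) (sq_nonneg _)
    have hn' : (0 : ℝ) < n := by exact_mod_cast hn
    refine le_of_mul_le_mul_left ?_ hn'
    linarith
  have hlim : Tendsto (fun n => (K + 3 * C) * a n) atTop (𝓝 0) := by
    simpa using ha0.const_mul (K + 3 * C)
  exact ge_of_tendsto hlim (eventually_atTop.2 ⟨1, key⟩)

/-! ### Decreasing sequences of closed subspaces -/

section

variable {H : Type v} [NormedAddCommGroup H] [InnerProductSpace ℂ H] [CompleteSpace H]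

open Filter Topology in
/-- The projections onto a decreasing sequence of closed subspaces converge to `0` at every vector
orthogonal to the intersection. -/
lemma tendsto_starProjection_zero {E : ℕ → Submodule ℂ H} (hE : Antitone E)
    [∀ k, (E k).HasOrthogonalProjection]
    {x : H} (hx : x ∈ (⨅ k, E k)ᗮ) :
    Tendsto (fun k => (E k).starProjection x) atTop (𝓝 0) := by
  have hEE : ∀ k, (E k)ᗮᗮ = E k := fun k => Submodule.orthogonal_orthogonal (E k)
  have hmem : x ∈ (⨆ k, (E k)ᗮ).topologicalClosure := by
    rw [← Submodule.orthogonal_orthogonal_eq_closure, ← Submodule.iInf_orthogonal]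
    simpa only [hEE] using hx
  have := Submodule.starProjection_tendsto_closure_iSup (fun k => (E k)ᗮ)
    (fun i j hij => Submodule.orthogonal_le (hE hij)) x
  rw [Submodule.starProjection_eq_self_iff.2 hmem] at this
  simpa [Submodule.starProjection_orthogonal_val] using this.const_sub x

/-- Let `T` be unitary, `E` a decreasing sequence of closed subspaces which `T` and `T⁻¹` shift by at
most one step, and `v` a sequence with orthogonal increments `v (k + 1) - v k ∈ E k` which grows at
most linearly and for which `β - v k + T (v k)` lies in `E (k - 1)`. If `T` has no nonzero invariant
vector in `⨅ k, E k`, then `β - v 0 + T (v 0)` is a limit of vectors `z - T z` with `z ∈ E 0`.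

By duality it must be orthogonal to each `x` orthogonal to all `z - T z`. For such `x`, the inner
product with `β - v k + T (v k)` does not depend on `k`; it is small on average because `x` is
orthogonal to `⨅ k, E k`, so that its components along `E` are square summable, while linear growth
limits those of `v`. -/
lemma mem_closure_sub_of_linear_growth (T : H ≃ₗᵢ[ℂ] H) {E : ℕ → Submodule ℂ H}
    (hE : Antitone E) (hcl : ∀ k, IsClosed (E k : Set H))
    (hT : ∀ k, ∀ z ∈ E (k + 1), T z ∈ E k) (hT' : ∀ k, ∀ z ∈ E (k + 1), T.symm z ∈ E k)
    (hinv : ∀ z, (∀ k, z ∈ E k) → T z = z → z = 0)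
    {v : ℕ → H} (hv : ∀ k, v k ∈ (E k)ᗮ) (hvv : ∀ m n, m ≤ n → v n - v m ∈ E m)
    {β : H} (hd : ∀ k, β - v (k + 1) + T (v (k + 1)) ∈ E k)
    {C : ℝ} (hC : ∀ k : ℕ, ‖v k‖ ≤ C * (k + 1)) :
    β - v 0 + T (v 0) ∈
      ((E 0).map ((LinearMap.id : H →ₗ[ℂ] H) - T.toLinearEquiv.toLinearMap)).topologicalClosure := by
  have hcomp : ∀ k, CompleteSpace (E k) := fun k => (hcl k).completeSpace_coe
  rw [← Submodule.orthogonal_orthogonal_eq_closure, Submodule.mem_orthogonal]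
  intro x hx
  have hx0 : ∀ z ∈ E 0, inner ℂ x (z - T z) = 0 := fun z hz =>
    (Submodule.mem_orthogonal' _ _).1 hx _ ⟨z, hz, rfl⟩
  have hperp : x ∈ (⨅ k, E k)ᗮ := by
    have hcl' : IsClosed ((⨅ k, E k : Submodule ℂ H) : Set H) := by
      rw [Submodule.coe_iInf]
      exact isClosed_iInter hcl
    have := hcl'.completeSpace_coe
    rw [← Submodule.starProjection_apply_eq_zero_iff]
    set p := (⨅ k, E k).starProjection x
    have hp : p ∈ ⨅ k, E k := Submodule.starProjection_apply_mem _ _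
    have hp' : ∀ k, p ∈ E k := (Submodule.mem_iInf _).1 hp
    have hTp : T p ∈ ⨅ k, E k := (Submodule.mem_iInf _).2 fun k => hT k p (hp' (k + 1))
    have h1 : inner ℂ p (p - T p) = 0 := by
      have h2 := Submodule.starProjection_inner_eq_zero (K := ⨅ k, E k) x _ (sub_mem hp hTp)
      rw [inner_sub_left, hx0 p (hp' 0), zero_sub, neg_eq_zero] at h2
      exact h2
    refine hinv p hp' ?_
    have h3 : ‖p - T p‖ ^ 2 = 0 := by
      rw [inner_sub_right, sub_eq_zero] at h1
      rw [norm_sub_sq (𝕜 := ℂ), ← h1, T.norm_map, inner_self_eq_norm_sq]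
      ring
    exact (sub_eq_zero.1 (norm_eq_zero.1 (pow_eq_zero_iff two_ne_zero |>.1 h3))).symm
  set P : ℕ → H := fun k => (E k).starProjection x
  have hPmem : ∀ k, P k ∈ E k := fun k => Submodule.starProjection_apply_mem _ _
  have hPlim := tendsto_starProjection_zero hE hperp
  have hconst : ∀ k, inner ℂ x (β - v k + T (v k)) = inner ℂ x (β - v 0 + T (v 0)) := by
    intro k
    have := hx0 _ (hvv 0 k (Nat.zero_le k))
    rw [← sub_eq_zero, ← inner_sub_right, ← neg_eq_zero, ← inner_neg_right, ← this, map_sub]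
    congr 1
    abel
  have hzv : ∀ k, ∀ z ∈ E k, inner ℂ z (v k) = 0 := fun k z hz =>
    (Submodule.mem_orthogonal _ _).1 (hv k) z hz
  have hzTv : ∀ k, ∀ z ∈ E (k + 1), inner ℂ z (T (v k)) = 0 := fun k z hz => by
    rw [← hzv k _ (hT' k z hz), ← T.inner_map_map (T.symm z) (v k), T.apply_symm_apply]
  -- Blocks of length two are used because `T` moves the subspaces `E k` by one step either way.
  have hr : ∀ k, ‖P k - P (k + 2)‖ ^ 2 = ‖P k‖ ^ 2 - ‖P (k + 2)‖ ^ 2 := by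
    intro k
    have h1 := Submodule.starProjection_inner_eq_zero (K := E k) x _
      (hE (Nat.le_add_right k 2) (hPmem (k + 2)))
    have h2 := Submodule.starProjection_inner_eq_zero (K := E (k + 2)) x _ (hPmem (k + 2))
    have h3 : inner ℂ (P k - P (k + 2)) (P (k + 2)) = 0 := by
      rw [← sub_sub_sub_cancel_left (P (k + 2)) (P k) x, inner_sub_left, h1, h2, sub_zero]
    have h4 := norm_add_sq (𝕜 := ℂ) (P k - P (k + 2)) (P (k + 2))
    rw [h3, sub_add_cancel] at h4
    simp only [map_zero] at h4
    linarith
  have hs : ∀ k, ‖v (k + 2) - v k‖ ^ 2 = ‖v (k + 2)‖ ^ 2 - ‖v k‖ ^ 2 := by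
    intro k
    have h3 := hzv k _ (hvv k (k + 2) (Nat.le_add_right k 2))
    have h4 := norm_add_sq (𝕜 := ℂ) (v (k + 2) - v k) (v k)
    rw [h3, sub_add_cancel] at h4
    simp only [map_zero] at h4
    linarith
  have hbound : ∀ k, ‖inner ℂ x (β - v 0 + T (v 0))‖ ≤
      2 * ‖β‖ * ‖P (k + 2)‖ + 2 * (‖P (k + 2) - P (k + 4)‖ * ‖v (k + 3) - v (k + 1)‖) := by
    intro k
    set d := β - v (k + 3) + T (v (k + 3)) with hddef
    set y := P (k + 2) - P (k + 4) with hy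
    set w := v (k + 3) - v (k + 1) with hw
    have hyE : y ∈ E (k + 2) := sub_mem (hPmem _) (hE (Nat.le_add_right (k + 2) 2) (hPmem _))
    have h1 : inner ℂ x d = inner ℂ (P (k + 2)) d := by
      have := Submodule.starProjection_inner_eq_zero (K := E (k + 2)) x _ (hd (k + 2))
      rwa [inner_sub_left, sub_eq_zero] at this
    have h2 : inner ℂ (P (k + 4)) d = inner ℂ (P (k + 4)) β := by
      rw [hddef, inner_add_right, inner_sub_right, hzTv (k + 3) _ (hPmem (k + 4)),
        hzv (k + 3) _ (hE (Nat.le_succ _) (hPmem (k + 4)))]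
      ring
    have h3 : inner ℂ y d = inner ℂ y (β - w + T w) := by
      rw [hddef, hw, map_sub]
      simp only [inner_add_right, inner_sub_right]
      rw [hzTv (k + 1) y hyE, hzv (k + 1) y (hE (Nat.le_succ _) hyE)]
      ring
    have h4 : inner ℂ x d = inner ℂ (P (k + 4)) β + inner ℂ y (β - w + T w) := by
      rw [← h2, ← h3, ← inner_add_left, hy, add_sub_cancel, h1]
    have h5 : ‖P (k + 4)‖ ≤ ‖P (k + 2)‖ :=
      (pow_le_pow_iff_left₀ (norm_nonneg _) (norm_nonneg _) two_ne_zero).1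
        (by linarith [hr (k + 2), sq_nonneg ‖P (k + 2) - P (k + 2 + 2)‖])
    have h6 : ‖y‖ ≤ ‖P (k + 2)‖ :=
      (pow_le_pow_iff_left₀ (norm_nonneg _) (norm_nonneg _) two_ne_zero).1
        (by linarith [hr (k + 2), sq_nonneg ‖P (k + 2 + 2)‖])
    have h7 : ‖β - w + T w‖ ≤ ‖β‖ + 2 * ‖w‖ := by
      have := norm_add_le (β - w) (T w)
      have := norm_sub_le β w
      rw [T.norm_map] at *
      linarith
    rw [← hconst (k + 3), ← hddef, h4]
    calc _ ≤ ‖P (k + 4)‖ * ‖β‖ + ‖y‖ * ‖β - w + T w‖ :=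
          (norm_add_le _ _).trans (add_le_add (norm_inner_le_norm _ _) (norm_inner_le_norm _ _))
      _ ≤ ‖P (k + 2)‖ * ‖β‖ + ‖y‖ * (‖β‖ + 2 * ‖w‖) := by gcongr
      _ ≤ _ := by nlinarith [mul_le_mul_of_nonneg_right h6 (norm_nonneg β)]
  have hC0 : 0 ≤ C := by simpa using (norm_nonneg _).trans (hC 0)
  have hfinal : ‖inner ℂ x (β - v 0 + T (v 0))‖ / 2 ≤ 0 := by
    refine nonpos_of_le_mul_add_mul (K := ‖β‖) (C := 2 * C) (a := fun j => ‖P (2 * j + 2)‖)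
      (r := fun j => ‖P (2 * j + 2) - P (2 * j + 4)‖)
      (s := fun j => ‖v (2 * j + 3) - v (2 * j + 1)‖) (q := fun j => ‖v (2 * j + 1)‖ ^ 2)
      (fun j => norm_nonneg _) ?_ (fun j => hr (2 * j + 2)) (fun j => hs (2 * j + 1))
      (fun j => sq_nonneg _) (by positivity) (norm_nonneg _) (fun j => ?_) (fun j => ?_)
    · have : Filter.Tendsto (fun j : ℕ => 2 * j + 2) Filter.atTop Filter.atTop :=
        Filter.tendsto_atTop_mono (fun j => show j ≤ _ by omega) Filter.tendsto_id
      simpa using (hPlim.comp this).norm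
    · refine pow_le_pow_left₀ (norm_nonneg _) ((hC _).trans (le_of_eq ?_)) 2
      push_cast; ring
    · linarith [hbound (2 * j)]
  exact norm_le_zero_iff.1 (by linarith)

end

namespace UnitaryRep

/-! ### Cocycles on finite subgroups -/

section

variable {G : Type u} [Group G] {H : Type v} [NormedAddCommGroup H] [InnerProductSpace ℂ H]

/-- The subspace of vectors fixed by every element of the subgroup `N`. -/
def fixedVectors (π : G →* (H ≃ₗᵢ[ℂ] H)) (N : Subgroup G) : Submodule ℂ H where
  carrier := {z | ∀ g ∈ N, π g z = z}
  add_mem' := by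
    intro y z hy hz g hg
    rw [map_add, hy g hg, hz g hg]
  zero_mem' := fun g _ => map_zero (π g)
  smul_mem' := by
    intro c z hz g hg
    rw [map_smul, hz g hg]

variable {π : G →* (H ≃ₗᵢ[ℂ] H)} {N : Subgroup G} {b : G → H}

lemma mem_fixedVectors {z : H} : z ∈ fixedVectors π N ↔ ∀ g ∈ N, π g z = z := Iff.rfl

lemma isClosed_fixedVectors : IsClosed (fixedVectors π N : Set H) := by
  have : (fixedVectors π N : Set H) = ⋂ g ∈ N, {z | π g z = z} := by
    ext z
    simp [mem_fixedVectors]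
  rw [this]
  exact isClosed_biInter fun g _ => isClosed_eq (π g).continuous continuous_id

lemma map_mul_apply (g h : G) (z : H) : π (g * h) z = π g (π h z) := by
  rw [map_mul]; rfl

lemma map_inv_apply_self (g : G) (z : H) : π g (π g⁻¹ z) = z := by
  rw [← map_mul_apply, mul_inv_cancel, map_one]; rfl

lemma symm_apply_eq (g : G) (z : H) : (π g).symm z = π g⁻¹ z := by
  rw [LinearIsometryEquiv.symm_apply_eq, map_inv_apply_self]

/-- A cocycle `b` is, on a finite subgroup `N`, the coboundary of a vector orthogonal to the
`N`-fixed vectors, namely of the average of `b` over `N`. -/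
lemma exists_primitive (hb : b ∈ oneCocycles π) (hN : (N : Set G).Finite) {R : ℝ}
    (hR : ∀ g ∈ N, ‖b g‖ ≤ R) :
    ∃ v ∈ (fixedVectors π N)ᗮ, (∀ g ∈ N, b g = v - π g v) ∧ ‖v‖ ≤ R := by
  have : Fintype N := hN.fintype
  have hb' : ∀ g h, b (g * h) = b g + π g (b h) := hb
  set v : H := (Fintype.card N : ℂ)⁻¹ • ∑ g : N, b g
  have hcard : (Fintype.card N : ℂ) ≠ 0 := Nat.cast_ne_zero.2 Fintype.card_ne_zero
  have hbv : ∀ g ∈ N, b g = v - π g v := by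
    intro g hg
    have h1 : ∑ h : N, b h = (Fintype.card N : ℂ) • b g + π g (∑ h : N, b h) := by
      have h0 := Equiv.sum_comp (Equiv.mulLeft (⟨g, hg⟩ : N)) fun h : N => b h
      refine h0.symm.trans ?_
      simp [hb', Finset.sum_add_distrib, ← Nat.cast_smul_eq_nsmul ℂ]
    have h2 : v = b g + π g v := by
      simp only [v]
      rw [map_smul]
      conv_lhs => rw [h1]
      rw [smul_add, inv_smul_smul₀ hcard]
    exact eq_sub_of_add_eq h2.symm
  refine ⟨v, (Submodule.mem_orthogonal _ _).2 fun z hz => ?_, hbv, ?_⟩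
  · rw [inner_smul_right, inner_sum, Finset.sum_eq_zero fun g _ => ?_, mul_zero]
    rw [hbv g g.2, inner_sub_right, sub_eq_zero]
    conv_rhs => rw [← mem_fixedVectors.1 hz g g.2, (π g).inner_map_map]
  · have hpos : (0 : ℝ) < Fintype.card N := Nat.cast_pos.2 Fintype.card_pos
    rw [norm_smul, norm_inv, Complex.norm_natCast, inv_mul_le_iff₀ hpos]
    refine (norm_sum_le _ _).trans ((Finset.sum_le_sum fun (g : N) _ => hR g g.2).trans ?_)
    simp

/-- If a cocycle `b` is the coboundary of `v` on `M`, then `b t - v + π t v` is fixed by every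
subgroup `N` of `M` with `t⁻¹ N t` contained in `M`. -/
lemma sub_add_map_mem_fixedVectors (hb : b ∈ oneCocycles π) {t : G} {M : Subgroup G} {v : H}
    (hv : ∀ g ∈ M, b g = v - π g v) (hNM : N ≤ M) (hN : ∀ g ∈ N, t⁻¹ * g * t ∈ M) :
    b t - v + π t v ∈ fixedVectors π N := by
  have hb' : ∀ g h, b (g * h) = b g + π g (b h) := hb
  intro g hg
  have h1 : b (g * t) = b (t * (t⁻¹ * g * t)) := by congr 1; group
  rw [hb', hb', hv g (hNM hg), hv _ (hN g hg), map_sub, ← map_mul_apply,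
    show t * (t⁻¹ * g * t) = g * t by group, map_mul_apply] at h1
  rw [map_add, map_sub, eq_sub_of_add_eq' h1]
  abel

end

/-! ### Approximating cocycles by coboundaries -/

section

variable {G : Type u} [Group G] {H : Type v} [NormedAddCommGroup H] [InnerProductSpace ℂ H]
  {π : G →* (H ≃ₗᵢ[ℂ] H)} {b : G → H}

open Filter Topology

/-- Convergence of coboundaries to a cocycle need only be checked on generators. -/
lemma tendsto_coboundary_of_closure_eq_top (hb : b ∈ oneCocycles π) {X : Set G}
    (hX : Subgroup.closure X = ⊤) {u : ℕ → H}
    (hu : ∀ g ∈ X, Tendsto (fun n => b g - (u n - π g (u n))) atTop (𝓝 0)) (g : G) :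
    Tendsto (fun n => b g - (u n - π g (u n))) atTop (𝓝 0) := by
  have hb' : ∀ g h, b (g * h) = b g + π g (b h) := hb
  have hmul : ∀ (g h : G) (z : H),
      b (g * h) - (z - π (g * h) z) = b g - (z - π g z) + π g (b h - (z - π h z)) := by
    intro g h z
    rw [hb', map_mul_apply]
    simp only [map_sub]
    abel
  have hone : b 1 = 0 := by simpa using hb' 1 1
  have hmap : ∀ (g : G) {y : ℕ → H}, Tendsto y atTop (𝓝 0) →
      Tendsto (fun n => π g (y n)) atTop (𝓝 0) := by
    intro g y hy
    have := ((π g).continuous.tendsto 0).comp hy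
    rwa [map_zero] at this
  have hg : g ∈ Subgroup.closure X := hX ▸ Subgroup.mem_top g
  induction hg using Subgroup.closure_induction with
  | mem g hg => exact hu g hg
  | one => simp [hone]
  | mul g h _ _ ihg ihh =>
    simp_rw [hmul]
    simpa using ihg.add (hmap g ihh)
  | inv g _ ih =>
    have h1 : ∀ n, b g⁻¹ - (u n - π g⁻¹ (u n)) = -π g⁻¹ (b g - (u n - π g (u n))) := by
      intro n
      have := hmul g⁻¹ g (u n)
      rw [inv_mul_cancel, hone, map_one] at this
      rw [eq_neg_iff_add_eq_zero, ← this]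
      simp
    simp_rw [h1]
    simpa using (hmap g⁻¹ ih).neg

/-- A representation without nonzero invariant vectors has vanishing reduced cohomology if the group
carries a linear filtration. -/
lemma mem_closure_oneCoboundaries [CompleteSpace H] {t : G} {Λ : ℕ → Subgroup G}
    (hΛ : IsLinearFiltration t Λ) (hπ : ∀ z : H, (∀ g, π g z = z) → z = 0)
    (b : oneCocycles π) : b ∈ (oneCoboundaries π).topologicalClosure := by
  obtain ⟨b, hb⟩ := b
  have hb' : ∀ g h, b (g * h) = b g + π g (b h) := hb
  obtain ⟨C, hC⟩ := hΛ.growth (fun g => ‖b g‖) fun g h => by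
    rw [hb', ← (π g).norm_map (b h)]
    exact norm_add_le _ _
  choose v hv hbv hvC using fun n => exists_primitive hb (hΛ.finite n) (hC n)
  have hlim := mem_closure_sub_of_linear_growth (π t) (E := fun n => fixedVectors π (Λ n))
    (fun m n hmn z hz g hg => hz g (hΛ.monotone hmn hg)) (fun _ => isClosed_fixedVectors)
    (fun n z hz g hg => ?_) (fun n z hz g hg => ?_) (fun z hz ht => hπ z fun g => ?_) hv
    (fun m n hmn g hg => ?_)
    (fun n => sub_add_map_mem_fixedVectors hb (hbv (n + 1)) (hΛ.monotone n.le_succ)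
      (hΛ.inv_conj_mem n)) hvC
  · obtain ⟨y, hy, hylim⟩ := mem_closure_iff_seq_limit.1 hlim
    choose z hz hzy using hy
    have hu : ∀ g ∈ insert t (Λ 0 : Set G),
        Tendsto (fun n => b g - ((v 0 + z n) - π g (v 0 + z n))) atTop (𝓝 0) := by
      rintro g (rfl | hg)
      · have h1 : ∀ n, b g - ((v 0 + z n) - π g (v 0 + z n)) =
            b g - v 0 + π g (v 0) - y n := by
          intro n
          rw [← hzy n, map_add]
          simp only [LinearMap.sub_apply, LinearMap.id_apply, LinearEquiv.coe_coe,
            LinearIsometryEquiv.coe_toLinearEquiv]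
          abel
        simp_rw [h1]
        simpa using hylim.const_sub (b g - v 0 + π g (v 0))
      · have h1 : ∀ n, b g - ((v 0 + z n) - π g (v 0 + z n)) = 0 := by
          intro n
          rw [map_add, hz n g hg, hbv 0 g hg]
          abel
        simp_rw [h1]
        exact tendsto_const_nhds
    refine mem_closure_of_tendsto (f := fun n => coboundary π (v 0 + z n)) (b := atTop) ?_
      (Eventually.of_forall fun n => ⟨_, rfl⟩)
    rw [tendsto_subtype_rng, tendsto_pi_nhds]
    intro g
    have := (tendsto_coboundary_of_closure_eq_top hb hΛ.closure_eq_top hu g).const_sub (b g)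
    simp only [sub_sub_cancel, sub_zero] at this
    exact this
  · rw [← map_mul_apply, show g * t = t * (t⁻¹ * g * t) by group, map_mul_apply,
      hz _ (hΛ.inv_conj_mem n g hg)]
  · rw [symm_apply_eq, ← map_mul_apply, show g * t⁻¹ = t⁻¹ * (t * g * t⁻¹) by group,
      map_mul_apply, hz _ (hΛ.conj_mem n g hg)]
  · have hg : g ∈ Subgroup.closure (insert t (Λ 0 : Set G)) :=
      hΛ.closure_eq_top ▸ Subgroup.mem_top g
    induction hg using Subgroup.closure_induction with
    | mem g hg =>
      rcases hg with rfl | hg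
      · exact ht
      · exact hz 0 g hg
    | one => rw [map_one]; rfl
    | mul g h _ _ ihg ihh => rw [map_mul_apply, ihh, ihg]
    | inv g _ ih => rw [← symm_apply_eq, LinearIsometryEquiv.symm_apply_eq, ih]
  · have h1 := hbv m g hg
    rw [hbv n g (hΛ.monotone hmn hg)] at h1
    rw [map_sub, ← sub_eq_sub_iff_sub_eq_sub.1 h1]

/-- A nonzero invariant vector spans a one-dimensional trivial subrepresentation. -/
lemma isSubrep_span_singleton {z : H} (hz : z ≠ 0) (hπ : ∀ g, π g z = z) :
    IsSubrep π (ℂ ∙ z) ∧ (∀ g, ∀ y ∈ ℂ ∙ z, π g y = y) := by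
  have h : ∀ g, ∀ y ∈ ℂ ∙ z, π g y = y := by
    intro g y hy
    obtain ⟨c, rfl⟩ := Submodule.mem_span_singleton.1 hy
    rw [map_smul, hπ]
  refine ⟨⟨by simpa using hz, Submodule.closed_of_finiteDimensional _, fun g y hy => ?_⟩, h⟩
  rwa [h g y hy]

lemma exists_invariant_vector [CompleteSpace H] {t : G} {Λ : ℕ → Subgroup G}
    (hΛ : IsLinearFiltration t Λ) (h : Nontrivial (ReducedH1 π)) :
    ∃ z : H, z ≠ 0 ∧ ∀ g, π g z = z := by
  by_contra! hne
  refine (Submodule.Quotient.nontrivial_iff.1 h) (eq_top_iff.2 fun b _ => ?_)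
  refine mem_closure_oneCoboundaries hΛ (fun z hz => ?_) b
  by_contra hz0
  obtain ⟨g, hg⟩ := hne z hz0
  exact hg (hz g)

end

end UnitaryRep

theorem theorem1p1 {G : Type u} [Group G] [Group.FG G] {L : Type w} [Group L]
    (S : GroupExtension L G (Multiplicative ℤ)) (hL : IsLocallyNormallyFinite L) :
    PropertyHT.{v, u} G ∧ PropertyHFD.{v, u} G := by
  obtain ⟨t, Λ, hΛ⟩ := exists_isLinearFiltration S hL
  refine ⟨fun H _ _ _ π h => ?_, fun H _ _ _ π h => ?_⟩ <;>
    obtain ⟨z, hz, hπ⟩ := UnitaryRep.exists_invariant_vector hΛ h <;>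
    have hW := UnitaryRep.isSubrep_span_singleton hz hπ
  · exact ⟨_, hW⟩
  · exact ⟨_, hW.1, inferInstance⟩
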